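/- Let $d\ge 0$ be an integer, let $\mathcal D\subset\mathbb R^d$ be compact and convex, let $\rho>0$, and let $k(x,x')=\Psi(x-x')$ be a stationary kernel that is symmetric and positive semidefinite on $\mathcal D$ (all its Gram matrices at points of $\mathcal D$ are symmetric positive semidefinite), where the real function $\Psi$ satisfies $\Psi(0)-\Psi(x-x')\le A_0\|x-x'\|_2^{\theta}$ for all $x,x'\in\mathcal D$ and some constants $A_0,\theta>0$. For $x_1,\dots,x_t\in\mathcal D$ put $k_t(x)=(k(x,x_1),\dots,k(x,x_t))^{\mathsf T}$, $K_t=(k(x_j,x_l))_{j,l=1}^t$, and let $\sigma_t(x)\ge 0$ be given by $\sigma_t^2(x)=k(x,x)-k_t(x)^{\mathsf T}(K_t+\rho I_t)^{-1}k_t(x)$. Let $\varepsilon_1,\varepsilon_2,\dots$ be independent sub-Gaussian random variables with mean zero and variance proxy $\varsigma^2$, $\varsigma\ge 0$, that is, $\mathbb E[\exp(s\varepsilon_j)]\le\exp(s^2\varsigma^2/2)$ for all $s\in\mathbb R$ and $j\ge 1$, and put $\boldsymbol\varepsilon_t=(\varepsilon_1,\dots,\varepsilon_t)^{\mathsf T}$.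 Let $C_{\mathsf{subG}}>0$ be any constant (for example, one depending only on $\varsigma^2$). Then there is a constant $C_1>0$ of the form $C_1=a\,b$, where $a>0$ depends only on $\varsigma$ and $C_{\mathsf{subG}}$, and $b>0$ depends only on $\Psi$, $\mathcal D$ and $\rho$, such that for every $t\ge 1$, every $\delta\in(0,1)$, all (deterministic) design points $x_1,\dots,x_t\in\mathcal D$, and all such noise sequences, $$\mathbb P\Bigl(\bigl|k_t(x)^{\mathsf T}(K_t+\rho I_t)^{-1}\boldsymbol\varepsilon_t\bigr|\le C_1\,\sigma_t(x)\sqrt{\ln(1+\rho t)\,\ln\bigl(e+C_{\mathsf{subG}}/\delta\bigr)}\ \text{ for all }x\in\mathcal D\Bigr)\ge 1-\delta ,$$ the event being measurable. -/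

import Mathlib

open MeasureTheory ProbabilityTheory
open scoped NNReal Matrix

/-- The Euclidean space `ℝ^d`. -/
abbrev Eucl (d : ℕ) : Type := EuclideanSpace ℝ (Fin d)

/-- The stationary kernel `k(x, x') = Ψ(x - x')`. -/
def stationaryKernel {d : ℕ} (Ψ : Eucl d → ℝ) (x x' : Eucl d) : ℝ := Ψ (x - x')

/-- The Gram matrix `K_t = (k(x_j, x_l))_{j,l}` of the points `x_1, …, x_t`. -/
def gramMatrix {d t : ℕ} (k : Eucl d → Eucl d → ℝ) (x : Fin t → Eucl d) :
    Matrix (Fin t) (Fin t) ℝ :=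
  Matrix.of fun j l => k (x j) (x l)

/-- `k` is a covariance function on `D`: it is symmetric on `D`, and all its Gram matrices at
points of `D` are positive semidefinite (`Matrix.PosSemidef` includes the symmetry). -/
def IsCovarianceOn {d : ℕ} (k : Eucl d → Eucl d → ℝ) (D : Set (Eucl d)) : Prop :=
  ∀ (n : ℕ) (x : Fin n → Eucl d), (∀ j, x j ∈ D) → (gramMatrix k x).PosSemidef

/-- `Ψ(0) - Ψ(x - x') ≤ A₀ ‖x - x'‖₂ ^ θ` on `D`, for some constants `A₀, θ > 0`. -/
def IsHolderOn {d : ℕ} (Ψ : Eucl d → ℝ) (D : Set (Eucl d)) : Prop :=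
  ∃ A₀ > (0 : ℝ), ∃ θ > (0 : ℝ), ∀ x ∈ D, ∀ x' ∈ D, Ψ 0 - Ψ (x - x') ≤ A₀ * ‖x - x'‖ ^ θ

/-- The vector `k_t(z) = (k(z, x_1), …, k(z, x_t))`. -/
def kernelVec {d t : ℕ} (k : Eucl d → Eucl d → ℝ) (x : Fin t → Eucl d) (z : Eucl d) :
    Fin t → ℝ :=
  fun j => k z (x j)

/-- The matrix `(K_t + ρ I_t)⁻¹`. -/
noncomputable def regInv {d t : ℕ} (k : Eucl d → Eucl d → ℝ) (ρ : ℝ) (x : Fin t → Eucl d) :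
    Matrix (Fin t) (Fin t) ℝ :=
  (gramMatrix k x + ρ • (1 : Matrix (Fin t) (Fin t) ℝ))⁻¹

/-- The posterior standard deviation `σ_t(z)`, the square root of
`σ_t²(z) = k(z, z) - k_t(z)ᵀ (K_t + ρ I_t)⁻¹ k_t(z)`. -/
noncomputable def posteriorStd {d t : ℕ} (k : Eucl d → Eucl d → ℝ) (ρ : ℝ)
    (x : Fin t → Eucl d) (z : Eucl d) : ℝ :=
  √(k z z - kernelVec k x z ⬝ᵥ (regInv k ρ x *ᵥ kernelVec k x z))

/-- The random error term `k_t(z)ᵀ (K_t + ρ I_t)⁻¹ e` for a noise vector `e`. -/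
noncomputable def randomError {d t : ℕ} (k : Eucl d → Eucl d → ℝ) (ρ : ℝ)
    (x : Fin t → Eucl d) (e : Fin t → ℝ) (z : Eucl d) : ℝ :=
  kernelVec k x z ⬝ᵥ (regInv k ρ x *ᵥ e)

/-- `ε_1, ε_2, …` (here `ε 0, ε 1, …`) are independent sub-Gaussian random variables with mean
zero and variance proxy `ς²`, that is, `𝔼[exp(s ε_j)] ≤ exp(s² ς² / 2)` for all real `s`. -/
structure IsSubGaussianNoise {Ω : Type*} [MeasurableSpace Ω] (P : Measure Ω) (ε : ℕ → Ω → ℝ)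
    (ς : ℝ≥0) : Prop where
  measurable : ∀ j, Measurable (ε j)
  indep : iIndepFun ε P
  mean_zero : ∀ j, ∫ ω, ε j ω ∂P = 0
  subgaussian : ∀ j, HasSubgaussianMGF (ε j) (ς ^ 2) P

/-- The event that the random error is at most `C₁ σ_t(z) √(ln(1 + ρ t) ln(e + C_subG / δ))` in
absolute value, for all `z ∈ D` simultaneously. -/
def errorBoundEvent {Ω : Type*} {d : ℕ} (k : Eucl d → Eucl d → ℝ) (D : Set (Eucl d)) (ρ : ℝ)
    (t : ℕ) (x : Fin t → Eucl d) (ε : ℕ → Ω → ℝ) (C₁ CsubG δ : ℝ) : Set Ω :=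
  {ω | ∀ z ∈ D, |randomError k ρ x (fun j : Fin t => ε j ω) z| ≤
    C₁ * posteriorStd k ρ x z *
      √(Real.log (1 + ρ * t) * Real.log (Real.exp 1 + CsubG / δ))}

/-! Write `w_z = (K_t + ρ I)⁻¹ k_t(z)`; the random error at `z` is the linear form `w_z ⬝ᵥ ε`.
Positive semidefiniteness gives `ρ ‖w_z‖² ≤ σ_t²(z)` (`mul_regWeight_sq_le`), so at a fixed point
the error is sub-Gaussian on the scale `σ_t(z) / √ρ`.

Uniformity in `z` comes from a union bound over a finite net of `D` together with the `t` noise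
coordinates. Off the net, `ρ ‖w_z - w_y‖²` is at most the squared kernel distance of `z` and `y`
(`mul_regWeight_sub_sq_le`), hence of order `t⁻²` by the Hölder bound, and `‖ε‖ ≤ √t max |ε_j|`. The
increment is absorbed because `σ_t²` is nowhere below a multiple of `1 / t` (`le_mul_posteriorVar`).
The net has size polynomial in `t`, so the union bound costs only `ln(1 + ρ t)`. If `Ψ 0 ≤ 0`, the
kernel vanishes on `D`. -/

/-! ### Deterministic inequalities for the posterior variance and the weights. -/

section PosteriorCovariance

variable {d t : ℕ} {k : Eucl d → Eucl d → ℝ} {D : Set (Eucl d)} {x : Fin t → Eucl d} {ρ : ℝ}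

/-- The weights `(K_t + ρ I_t)⁻¹ k_t(z)`. -/
noncomputable def regWeight (k : Eucl d → Eucl d → ℝ) (ρ : ℝ) (x : Fin t → Eucl d)
    (z : Eucl d) : Fin t → ℝ :=
  regInv k ρ x *ᵥ kernelVec k x z

/-- Quadratic form of the Gram matrix of `y, z, x_1, …, x_t` at the vector `(a, b, v)`. -/
theorem IsCovarianceOn.quadratic_nonneg (hk : IsCovarianceOn k D) (hx : ∀ j, x j ∈ D)
    {y z : Eucl d} (hy : y ∈ D) (hz : z ∈ D) (a b : ℝ) (v : Fin t → ℝ) :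
    0 ≤ a ^ 2 * k y y + 2 * (a * b) * k y z + b ^ 2 * k z z
      + 2 * (v ⬝ᵥ (a • kernelVec k x y + b • kernelVec k x z))
      + v ⬝ᵥ (gramMatrix k x *ᵥ v) := by
  have hp : ∀ j, (Fin.cons y (Fin.cons z x) : Fin (t + 2) → Eucl d) j ∈ D := by
    intro j
    refine Fin.cases ?_ (fun j => Fin.cases ?_ (fun j => ?_) j) j
    · simpa using hy
    · simpa using hz
    · simpa using hx j
  have hpsd := hk _ _ hp
  have hsym : ∀ i j, k ((Fin.cons y (Fin.cons z x) : Fin (t + 2) → Eucl d) i)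
      ((Fin.cons y (Fin.cons z x) : Fin (t + 2) → Eucl d) j) =
      k ((Fin.cons y (Fin.cons z x) : Fin (t + 2) → Eucl d) j)
      ((Fin.cons y (Fin.cons z x) : Fin (t + 2) → Eucl d) i) := fun i j => by
    simpa [gramMatrix] using (hpsd.1.apply i j).symm
  have h1 : k z y = k y z := by simpa using hsym 1 0
  have h2 : ∀ j, k (x j) y = k y (x j) := fun j => by simpa using hsym j.succ.succ 0
  have h3 : ∀ j, k (x j) z = k z (x j) := fun j => by simpa using hsym j.succ.succ 1
  have h := hpsd.dotProduct_mulVec_nonneg (Fin.cons a (Fin.cons b v))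
  simp only [gramMatrix, dotProduct, Matrix.mulVec, Fin.sum_univ_succ, Matrix.of_apply,
    star_trivial, Fin.cons_zero, Fin.cons_succ, h1, h2, h3, mul_add,
    Finset.sum_add_distrib] at h
  refine h.trans_eq ?_
  simp only [kernelVec, gramMatrix, dotProduct, Matrix.mulVec, Matrix.of_apply, Pi.add_apply,
    Pi.smul_apply, smul_eq_mul, mul_add, Finset.sum_add_distrib, Finset.mul_sum]
  have e1 : ∀ (c : ℝ) (q : Eucl d), ∑ i, v i * (k q (x i) * c) = ∑ i, v i * (c * k q (x i)) :=
    fun c q => Finset.sum_congr rfl fun i _ => by ring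
  have e2 : ∀ (c : ℝ) (q : Eucl d), ∑ i, c * (k q (x i) * v i) = ∑ i, v i * (c * k q (x i)) :=
    fun c q => Finset.sum_congr rfl fun i _ => by ring
  have e3 : ∀ (c : ℝ) (q : Eucl d), ∑ i, 2 * (v i * (c * k q (x i))) =
    2 * ∑ i, v i * (c * k q (x i)) := fun c q => (Finset.mul_sum _ _ _).symm
  rw [e1, e1, e2, e2, e3, e3]
  ring

theorem IsCovarianceOn.posDef_regularized (hk : IsCovarianceOn k D) (hx : ∀ j, x j ∈ D)
    (hρ : 0 < ρ) : (gramMatrix k x + ρ • (1 : Matrix (Fin t) (Fin t) ℝ)).PosDef :=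
  Matrix.PosDef.posSemidef_add (hk t x hx) (Matrix.PosDef.one.smul hρ)

theorem IsCovarianceOn.gramMatrix_mulVec_regWeight (hk : IsCovarianceOn k D)
    (hx : ∀ j, x j ∈ D) (hρ : 0 < ρ) (z : Eucl d) :
    gramMatrix k x *ᵥ regWeight k ρ x z = kernelVec k x z - ρ • regWeight k ρ x z := by
  have hdet := (Matrix.isUnit_iff_isUnit_det _).1 (hk.posDef_regularized hx hρ).isUnit
  have h : (gramMatrix k x + ρ • (1 : Matrix (Fin t) (Fin t) ℝ)) *ᵥ regWeight k ρ x z =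
      kernelVec k x z := by
    rw [regWeight, regInv, Matrix.mulVec_mulVec, Matrix.mul_nonsing_inv _ hdet, Matrix.one_mulVec]
  rw [Matrix.add_mulVec, Matrix.smul_mulVec, Matrix.one_mulVec] at h
  exact eq_sub_of_add_eq h

theorem IsCovarianceOn.regInv_isSymm (hk : IsCovarianceOn k D) (hx : ∀ j, x j ∈ D)
    (hρ : 0 < ρ) : (regInv k ρ x)ᵀ = regInv k ρ x := by
  have h := (hk.posDef_regularized hx hρ).1.inv
  simpa [Matrix.IsHermitian, regInv, Matrix.conjTranspose_eq_transpose_of_trivial] using h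

theorem IsCovarianceOn.kernelVec_dotProduct_regInv (hk : IsCovarianceOn k D)
    (hx : ∀ j, x j ∈ D) (hρ : 0 < ρ) (z : Eucl d) (e : Fin t → ℝ) :
    kernelVec k x z ⬝ᵥ (regInv k ρ x *ᵥ e) = regWeight k ρ x z ⬝ᵥ e := by
  rw [Matrix.dotProduct_mulVec, ← Matrix.mulVec_transpose, hk.regInv_isSymm hx hρ, regWeight]

/-- The posterior variance `k(z, z) - k_t(z)ᵀ (K_t + ρ I_t)⁻¹ k_t(z)`. -/
noncomputable def posteriorVar (k : Eucl d → Eucl d → ℝ) (ρ : ℝ) (x : Fin t → Eucl d)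
    (z : Eucl d) : ℝ :=
  k z z - kernelVec k x z ⬝ᵥ regWeight k ρ x z

/-- The posterior covariance `k(y, z) - k_t(y)ᵀ (K_t + ρ I_t)⁻¹ k_t(z)`. -/
noncomputable def posteriorCov (k : Eucl d → Eucl d → ℝ) (ρ : ℝ) (x : Fin t → Eucl d)
    (y z : Eucl d) : ℝ :=
  k y z - kernelVec k x y ⬝ᵥ regWeight k ρ x z

/-- Take `v = -(a w_y + b w_z)` in `quadratic_nonneg` and eliminate `K_t` through `K_t w = k_t - ρ
w`. -/
theorem IsCovarianceOn.mul_dotProduct_regWeight_le (hk : IsCovarianceOn k D)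
    (hx : ∀ j, x j ∈ D) (hρ : 0 < ρ) {y z : Eucl d} (hy : y ∈ D) (hz : z ∈ D) (a b : ℝ) :
    ρ * ((a • regWeight k ρ x y + b • regWeight k ρ x z) ⬝ᵥ
        (a • regWeight k ρ x y + b • regWeight k ρ x z)) ≤
      a ^ 2 * posteriorVar k ρ x y + 2 * (a * b) * posteriorCov k ρ x y z
        + b ^ 2 * posteriorVar k ρ x z := by
  have h := hk.quadratic_nonneg hx hy hz a b
    (-(a • regWeight k ρ x y + b • regWeight k ρ x z))
  have hc : kernelVec k x y ⬝ᵥ regWeight k ρ x z = kernelVec k x z ⬝ᵥ regWeight k ρ x y := by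
    conv_lhs => rw [regWeight, hk.kernelVec_dotProduct_regInv hx hρ]
    rw [dotProduct_comm]
  have e1 : ∀ u v : Eucl d, regWeight k ρ x u ⬝ᵥ kernelVec k x v =
      kernelVec k x v ⬝ᵥ regWeight k ρ x u := fun u v => dotProduct_comm _ _
  simp only [Matrix.mulVec_neg, Matrix.mulVec_add, Matrix.mulVec_smul,
    hk.gramMatrix_mulVec_regWeight hx hρ, neg_dotProduct, dotProduct_neg,
    add_dotProduct, dotProduct_add, smul_dotProduct, dotProduct_smul, smul_eq_mul,
    dotProduct_sub, e1, ← hc] at h ⊢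
  simp only [posteriorVar, posteriorCov]
  linarith

theorem IsCovarianceOn.mul_regWeight_sq_le (hk : IsCovarianceOn k D)
    (hx : ∀ j, x j ∈ D) (hρ : 0 < ρ) {z : Eucl d} (hz : z ∈ D) :
    ρ * (regWeight k ρ x z ⬝ᵥ regWeight k ρ x z) ≤ posteriorVar k ρ x z := by
  simpa using hk.mul_dotProduct_regWeight_le hx hρ hz hz 1 0

theorem dotProduct_self_nonneg_real {ι : Type*} [Fintype ι] (v : ι → ℝ) : 0 ≤ v ⬝ᵥ v :=
  Finset.sum_nonneg fun _ _ => mul_self_nonneg _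

/-- Conditioning shrinks the kernel distance: the gap between the two sides is the form of `K_t + ρ
I` at `w_y - w_z`. -/
theorem IsCovarianceOn.posteriorVar_sub_le (hk : IsCovarianceOn k D)
    (hx : ∀ j, x j ∈ D) (hρ : 0 < ρ) (y z : Eucl d) :
    posteriorVar k ρ x y - 2 * posteriorCov k ρ x y z + posteriorVar k ρ x z ≤
      k y y - 2 * k y z + k z z := by
  have hc : kernelVec k x y ⬝ᵥ regWeight k ρ x z = kernelVec k x z ⬝ᵥ regWeight k ρ x y := by
    conv_lhs => rw [regWeight, hk.kernelVec_dotProduct_regInv hx hρ]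
    rw [dotProduct_comm]
  have h := (hk t x hx).dotProduct_mulVec_nonneg (regWeight k ρ x y - regWeight k ρ x z)
  have h' := mul_nonneg hρ.le
    (dotProduct_self_nonneg_real (regWeight k ρ x y - regWeight k ρ x z))
  have e1 : ∀ u v : Eucl d, regWeight k ρ x u ⬝ᵥ kernelVec k x v =
      kernelVec k x v ⬝ᵥ regWeight k ρ x u := fun u v => dotProduct_comm _ _
  simp only [star_trivial, Matrix.mulVec_sub, hk.gramMatrix_mulVec_regWeight hx hρ,
    sub_dotProduct, dotProduct_sub, dotProduct_smul, smul_eq_mul, e1, ← hc] at h h'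
  simp only [posteriorVar, posteriorCov]
  linarith

theorem IsCovarianceOn.mul_regWeight_sub_sq_le (hk : IsCovarianceOn k D)
    (hx : ∀ j, x j ∈ D) (hρ : 0 < ρ) {y z : Eucl d} (hy : y ∈ D) (hz : z ∈ D) :
    ρ * ((regWeight k ρ x y - regWeight k ρ x z) ⬝ᵥ
      (regWeight k ρ x y - regWeight k ρ x z)) ≤ k y y - 2 * k y z + k z z := by
  have h := hk.mul_dotProduct_regWeight_le hx hρ hy hz 1 (-1)
  have h' := hk.posteriorVar_sub_le hx hρ y z
  rw [one_smul, neg_one_smul, ← sub_eq_add_neg] at h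
  linarith

/-- The coefficients `(1, -2)` give `4 cov ≤ σ²(y) + 4 σ²(z)`, which eliminates the covariance from
`posteriorVar_sub_le`. -/
theorem IsCovarianceOn.posteriorVar_le_two_mul_add (hk : IsCovarianceOn k D)
    (hx : ∀ j, x j ∈ D) (hρ : 0 < ρ) {y z : Eucl d} (hy : y ∈ D) (hz : z ∈ D) :
    posteriorVar k ρ x y ≤ 2 * posteriorVar k ρ x z + 2 * (k y y - 2 * k y z + k z z) := by
  have h := (mul_nonneg hρ.le (dotProduct_self_nonneg_real _)).trans
    (hk.mul_dotProduct_regWeight_le hx hρ hy hz 1 (-2))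
  have h' := hk.posteriorVar_sub_le hx hρ y z
  linarith

theorem IsCovarianceOn.symm (hk : IsCovarianceOn k D) {y z : Eucl d} (hy : y ∈ D)
    (hz : z ∈ D) : k y z = k z y := by
  have h := (hk 2 ![y, z] (by intro j; fin_cases j <;> simpa)).1.apply 1 0
  simpa [gramMatrix] using h

theorem IsCovarianceOn.two_mul_abs_le (hk : IsCovarianceOn k D) {y z : Eucl d} (hy : y ∈ D)
    (hz : z ∈ D) : 2 * |k y z| ≤ k y y + k z z := by
  have h1 := hk.quadratic_nonneg (x := ![]) (fun j => j.elim0) hy hz 1 1 ![]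
  have h2 := hk.quadratic_nonneg (x := ![]) (fun j => j.elim0) hy hz 1 (-1) ![]
  simp at h1 h2
  rw [← abs_two, ← abs_mul, abs_le]
  constructor <;> linarith

theorem IsCovarianceOn.gramMatrix_quadratic_le (hk : IsCovarianceOn k D) (hx : ∀ j, x j ∈ D)
    {κ : ℝ} (hκ : ∀ z ∈ D, k z z = κ) (v : Fin t → ℝ) :
    v ⬝ᵥ (gramMatrix k x *ᵥ v) ≤ t * κ * (v ⬝ᵥ v) := by
  have hterm : ∀ i j, v i * (k (x i) (x j) * v j) ≤ κ / 2 * (v i * v i) + κ / 2 * (v j * v j) := by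
    intro i j
    have hij := hk.two_mul_abs_le (hx i) (hx j)
    rw [hκ _ (hx i), hκ _ (hx j)] at hij
    have h1 : v i * (k (x i) (x j) * v j) ≤ |k (x i) (x j)| * |v i * v j| := by
      rw [← abs_mul]
      exact (le_of_eq (by ring)).trans (le_abs_self _)
    have h2 : |v i * v j| ≤ (v i * v i + v j * v j) / 2 := by
      rw [abs_le]
      constructor <;> nlinarith [sq_nonneg (v i + v j), sq_nonneg (v i - v j)]
    have h3 := mul_le_mul (show |k (x i) (x j)| ≤ κ by linarith) h2 (abs_nonneg _)
      (by linarith [abs_nonneg (k (x i) (x j))])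
    linarith
  calc v ⬝ᵥ (gramMatrix k x *ᵥ v) = ∑ i, ∑ j, v i * (k (x i) (x j) * v j) := by
        simp [dotProduct, Matrix.mulVec, gramMatrix, Finset.mul_sum]
    _ ≤ ∑ i, ∑ j, (κ / 2 * (v i * v i) + κ / 2 * (v j * v j)) :=
        Finset.sum_le_sum fun i _ => Finset.sum_le_sum fun j _ => hterm i j
    _ = t * κ * (v ⬝ᵥ v) := by
        simp only [Finset.sum_add_distrib, Finset.sum_const, Finset.card_univ,
          Fintype.card_fin, nsmul_eq_mul, dotProduct]
        simp only [← Finset.mul_sum]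
        ring

theorem IsCovarianceOn.le_mul_posteriorVar (hk : IsCovarianceOn k D) (hx : ∀ j, x j ∈ D)
    (hρ : 0 < ρ) {κ : ℝ} (hκ : ∀ z ∈ D, k z z = κ) {z : Eucl d} (hz : z ∈ D) :
    κ ≤ 2 * (1 + t * κ / ρ) * posteriorVar k ρ x z := by
  set w := regWeight k ρ x z with hw
  have hκ0 : 0 ≤ κ := by
    have := hk.two_mul_abs_le hz hz
    rw [hκ z hz] at this
    linarith [abs_nonneg κ]
  -- Together with `h5` this says `4 ρ ‖w‖² ≤ κ`. In the splitting `κ = σ² + wᵀ K w + ρ ‖w‖²` the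
  -- last term is then absorbed on the left, and `h7` bounds the middle one.
  have h1 := hk.quadratic_nonneg hx hz hz 1 0 ((-2 : ℝ) • w)
  have h2 := hk.gramMatrix_quadratic_le hx hκ w
  have h3 := hk.mul_regWeight_sq_le hx hρ hz
  have h4 := hk.gramMatrix_mulVec_regWeight hx hρ z
  have h5 : w ⬝ᵥ (gramMatrix k x *ᵥ w) = kernelVec k x z ⬝ᵥ w - ρ * (w ⬝ᵥ w) := by
    rw [hw, h4, dotProduct_sub, dotProduct_smul, smul_eq_mul, dotProduct_comm]
  simp only [Matrix.mulVec_smul, dotProduct_smul, smul_dotProduct, smul_eq_mul, one_smul,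
    zero_smul, add_zero, hκ z hz, dotProduct_comm w (kernelVec k x z)] at h1
  have h6 : posteriorVar k ρ x z = κ - kernelVec k x z ⬝ᵥ w := by
    rw [posteriorVar, hκ z hz]
  have h7 : t * κ * (w ⬝ᵥ w) ≤ t * κ / ρ * posteriorVar k ρ x z := by
    rw [div_mul_eq_mul_div, le_div_iff₀ hρ, mul_assoc, mul_comm (w ⬝ᵥ w)]
    exact mul_le_mul_of_nonneg_left h3 (by positivity)
  have h8 := mul_nonneg hρ.le (dotProduct_self_nonneg_real w)
  nlinarith

end PosteriorCovariance

/-! ### Nets of polynomial size. -/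

theorem exists_finset_net_card_le {d : ℕ} {D : Set (Eucl d)} (hD : Bornology.IsBounded D) :
    ∃ B : ℝ, 0 < B ∧ ∀ r : ℝ, 0 < r → ∃ s : Finset (Eucl d), (∀ y ∈ s, y ∈ D) ∧
      (∀ z ∈ D, ∃ y ∈ s, ‖z - y‖ ≤ r) ∧ (s.card : ℝ) ≤ (B * (1 + 1 / r)) ^ d := by
  classical
  obtain ⟨R, hR0, hR⟩ := hD.exists_pos_norm_le
  refine ⟨2 * R * (d + 1) + 3, by positivity, fun r hr => ?_⟩
  -- A cell of side `h` has diameter at most `√d h ≤ r`; `d + 1` also covers `d = 0`.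
  set h : ℝ := r / (d + 1) with hh
  have hpos : 0 < h := by positivity
  set cell : Eucl d → Fin d → ℤ := fun z i => ⌊z i / h⌋ with hcell
  set m : ℕ := ⌈R / h⌉₊ with hm
  have hmR : R / h ≤ m := Nat.le_ceil _
  have hmle : (m : ℝ) < R / h + 1 := Nat.ceil_lt_add_one (by positivity)
  set T : Finset (Fin d → ℤ) := Fintype.piFinset fun _ => Finset.Icc (-(m : ℤ)) m with hT
  have hcellT : ∀ z ∈ D, cell z ∈ T := by
    intro z hz
    rw [hT, Fintype.mem_piFinset]
    intro i
    have habs : |z i / h| ≤ m := by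
      rw [abs_div, abs_of_pos hpos]
      refine le_trans ?_ hmR
      gcongr
      exact (PiLp.norm_apply_le z i).trans (hR z hz)
    rw [abs_le] at habs
    rw [Finset.mem_Icc]
    constructor
    · rw [Int.le_floor]
      push_cast
      exact habs.1
    · have := (Int.floor_le (z i / h)).trans habs.2
      exact Int.cast_le (R := ℝ) |>.1 (by push_cast; exact this)
  -- Representatives are chosen in `D`, since the kernel inequalities hold only there.
  set rep : (Fin d → ℤ) → Eucl d := fun c =>
    if hc : ∃ z ∈ D, cell z = c then hc.choose else 0 with hrep
  have hrep_spec : ∀ c, (∃ z ∈ D, cell z = c) → rep c ∈ D ∧ cell (rep c) = c := by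
    intro c hc
    simp only [hrep, dif_pos hc]
    exact hc.choose_spec
  refine ⟨(T.filter fun c => ∃ z ∈ D, cell z = c).image rep, ?_, ?_, ?_⟩
  · intro y hy
    obtain ⟨c, hc, rfl⟩ := Finset.mem_image.1 hy
    exact (hrep_spec c (Finset.mem_filter.1 hc).2).1
  · intro z hz
    refine ⟨rep (cell z), Finset.mem_image_of_mem _
      (Finset.mem_filter.2 ⟨hcellT z hz, z, hz, rfl⟩), ?_⟩
    have hcz := (hrep_spec (cell z) ⟨z, hz, rfl⟩).2
    have hcoord : ∀ i, ‖(z - rep (cell z)) i‖ ^ 2 ≤ h ^ 2 := by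
      intro i
      have h1 := Int.abs_sub_lt_one_of_floor_eq_floor (congrFun hcz i).symm
      rw [← sub_div, abs_div, abs_of_pos hpos, div_lt_one hpos] at h1
      gcongr
      exact h1.le
    rw [EuclideanSpace.norm_eq]
    refine Real.sqrt_le_iff.2 ⟨hr.le, (Finset.sum_le_sum fun i _ => hcoord i).trans ?_⟩
    have hrh : r = h * (d + 1) := by rw [hh]; field_simp
    rw [Finset.sum_const, Finset.card_univ, Fintype.card_fin, nsmul_eq_mul, hrh]
    have : (0 : ℝ) ≤ d := Nat.cast_nonneg d
    nlinarith [mul_nonneg (sq_nonneg h) this, mul_nonneg (sq_nonneg h) (mul_nonneg this this)]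
  · have h1 : (((T.filter fun c => ∃ z ∈ D, cell z = c).image rep).card : ℝ) ≤ T.card := by
      exact_mod_cast Finset.card_image_le.trans (Finset.card_filter_le _ _)
    refine h1.trans ?_
    have h2 : T.card = (2 * m + 1) ^ d := by
      rw [hT, Fintype.card_piFinset]
      simp only [Int.card_Icc, Finset.prod_const, Finset.card_univ, Fintype.card_fin]
      congr 1
      omega
    rw [h2]
    push_cast
    have h3 : R / h = R * (d + 1) * (1 / r) := by rw [hh]; field_simp
    have h4 : 0 < 1 / r := by positivity
    have h5 : 0 < R * (d + 1) := by positivity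
    gcongr
    nlinarith

theorem exists_net_card_le_mul_pow {d : ℕ} {D : Set (Eucl d)} (hD : Bornology.IsBounded D)
    {A θ c : ℝ} (hA : 0 < A) (hθ : 0 < θ) (hc : 0 < c) :
    ∃ B : ℝ, 0 < B ∧ ∃ p : ℕ, ∀ t : ℕ, 1 ≤ t → ∃ s : Finset (Eucl d), (∀ y ∈ s, y ∈ D) ∧
      (∀ z ∈ D, ∃ y ∈ s, A * ‖z - y‖ ^ θ ≤ c / t ^ 2) ∧ (s.card : ℝ) ≤ B * t ^ p := by
  obtain ⟨B, hB, hnet⟩ := exists_finset_net_card_le hD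
  obtain ⟨q, hq⟩ := exists_nat_ge (2 / θ)
  -- `A r ^ θ = c`, and `q θ ≥ 2` makes radius `r / t ^ q` sufficient; a natural `q` keeps the
  -- cardinality a power of `t`.
  set r : ℝ := (c / A) ^ (1 / θ) with hr
  have hr0 : 0 < r := Real.rpow_pos_of_pos (by positivity) _
  refine ⟨(B * (1 + 1 / r)) ^ d, by positivity, q * d, fun t ht => ?_⟩
  have ht' : (1 : ℝ) ≤ t := by exact_mod_cast ht
  have ht0 : (0 : ℝ) < t := by linarith
  obtain ⟨s, hsD, hs, hcard⟩ := hnet (r / t ^ q) (by positivity)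
  refine ⟨s, hsD, fun z hz => ?_, hcard.trans ?_⟩
  · obtain ⟨y, hy, hzy⟩ := hs z hz
    refine ⟨y, hy, ?_⟩
    have h1 : ‖z - y‖ ^ θ ≤ (r / t ^ q) ^ θ := Real.rpow_le_rpow (norm_nonneg _) hzy hθ.le
    have h2 : r ^ θ = c / A := by
      rw [hr, ← Real.rpow_mul (by positivity), one_div, inv_mul_cancel₀ hθ.ne', Real.rpow_one]
    have h3 : (t : ℝ) ^ 2 ≤ ((t : ℝ) ^ q) ^ θ := by
      rw [← Real.rpow_natCast, ← Real.rpow_natCast, ← Real.rpow_mul ht0.le]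
      refine Real.rpow_le_rpow_of_exponent_le ht' ?_
      rw [div_le_iff₀ hθ] at hq
      exact_mod_cast hq
    rw [Real.div_rpow hr0.le (by positivity), h2] at h1
    calc A * ‖z - y‖ ^ θ ≤ A * (c / A / ((t : ℝ) ^ q) ^ θ) := by gcongr
      _ ≤ A * (c / A / t ^ 2) := by gcongr
      _ = c / t ^ 2 := by field_simp
  · rw [pow_mul, ← mul_pow]
    have h1 : (1 : ℝ) ≤ t ^ q := one_le_pow₀ ht'
    have h2 : 1 / (r / t ^ q) = 1 / r * t ^ q := by field_simp
    have h3 : 0 < 1 / r := by positivity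
    rw [h2, mul_assoc]
    gcongr
    nlinarith

/-! ### Comparison of logarithms. -/

/-- Bernoulli's inequality, with exponent `1 + 1 / ρ` because it must be at least `1`. -/
theorem log_one_add_le_mul_log_one_add_mul {ρ : ℝ} (hρ : 0 < ρ) {t : ℝ} (ht : 0 ≤ t) :
    Real.log (1 + t) ≤ (1 + 1 / ρ) * Real.log (1 + ρ * t) := by
  have h := one_add_mul_self_le_rpow_one_add (s := ρ * t) (by nlinarith [mul_nonneg hρ.le ht])
    (p := 1 + 1 / ρ) (by linarith [show 0 < 1 / ρ by positivity])
  have h0 : 0 < 1 + ρ * t := by positivity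
  rw [← Real.log_rpow h0]
  refine Real.log_le_log (by positivity) (le_trans ?_ h)
  have : (1 + 1 / ρ) * (ρ * t) = ρ * t + t := by field_simp
  nlinarith [mul_nonneg hρ.le ht]

theorem exists_log_two_mul_add_le {B ρ : ℝ} (hB : 0 < B) (hρ : 0 < ρ) (p : ℕ) :
    ∃ E : ℝ, 0 < E ∧ ∀ t n : ℕ, 1 ≤ t → (n : ℝ) ≤ B * t ^ p →
      Real.log (2 * (t + n)) ≤ E * Real.log (1 + ρ * t) := by
  have hl : 0 < Real.log (1 + ρ) := Real.log_pos (by linarith)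
  have hl' : 0 < Real.log (2 * (1 + B) ) := Real.log_pos (by linarith)
  refine ⟨Real.log (2 * (1 + B)) / Real.log (1 + ρ) + (p + 1) * (1 + 1 / ρ), by positivity,
    fun t n ht hn => ?_⟩
  have ht' : (1 : ℝ) ≤ t := by exact_mod_cast ht
  have h1 : (1 : ℝ) ≤ t ^ p := one_le_pow₀ ht'
  have h2 : 2 * (t + n) ≤ 2 * (1 + B) * (1 + (t : ℝ)) ^ (p + 1) := by
    have h3 : (t : ℝ) ^ (p + 1) ≤ (1 + (t : ℝ)) ^ (p + 1) := by gcongr; linarith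
    have h4 : (t : ℝ) ≤ t ^ (p + 1) := by rw [pow_succ]; nlinarith
    have h5 : (t : ℝ) ^ p ≤ t ^ (p + 1) := by rw [pow_succ]; nlinarith
    nlinarith
  have h6 : Real.log (1 + ρ) ≤ Real.log (1 + ρ * t) :=
    Real.log_le_log (by linarith) (by nlinarith)
  calc Real.log (2 * (t + n)) ≤ Real.log (2 * (1 + B) * (1 + (t : ℝ)) ^ (p + 1)) :=
        Real.log_le_log (by positivity) h2
    _ = Real.log (2 * (1 + B)) + (p + 1) * Real.log (1 + t) := by
        rw [Real.log_mul (by positivity) (by positivity), Real.log_pow]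
        push_cast
        ring
    _ ≤ Real.log (2 * (1 + B)) / Real.log (1 + ρ) * Real.log (1 + ρ * t)
        + (p + 1) * ((1 + 1 / ρ) * Real.log (1 + ρ * t)) := by
        gcongr
        · rw [div_mul_eq_mul_div, le_div_iff₀ hl]
          gcongr
        · exact log_one_add_le_mul_log_one_add_mul hρ (by linarith)
    _ = _ := by ring

theorem one_le_log_exp_one_add {y : ℝ} (hy : 0 ≤ y) : 1 ≤ Real.log (Real.exp 1 + y) := by
  rw [Real.le_log_iff_exp_le (by positivity)]
  linarith

theorem log_inv_le_mul_log_exp_one_add_div {C δ : ℝ} (hC : 0 < C) (hδ : 0 < δ) :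
    Real.log δ⁻¹ ≤ (1 + |Real.log C|) * Real.log (Real.exp 1 + C / δ) := by
  have h1 := one_le_log_exp_one_add (y := C / δ) (by positivity)
  have h2 : Real.log (C / δ) ≤ Real.log (Real.exp 1 + C / δ) :=
    Real.log_le_log (by positivity) (by linarith [Real.exp_pos 1])
  rw [Real.log_div hC.ne' hδ.ne'] at h2
  rw [Real.log_inv]
  nlinarith [neg_abs_le (Real.log C), abs_nonneg (Real.log C)]

/-- The sum `log N + log δ⁻¹` becomes a product because both factors are bounded below: `l ≥ m`, and
the summand `e` makes the other logarithm at least `1`. -/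
theorem log_div_le_mul_log_mul_log {N E l m C δ : ℝ} (hN : 0 < N) (hE : 0 ≤ E) (hm : 0 < m)
    (hml : m ≤ l) (hNE : Real.log N ≤ E * l) (hC : 0 < C) (hδ : 0 < δ) :
    Real.log (N / δ) ≤
      (E + 1 / m) * (1 + |Real.log C|) * (l * Real.log (Real.exp 1 + C / δ)) := by
  have h1 := one_le_log_exp_one_add (y := C / δ) (by positivity)
  have h2 := log_inv_le_mul_log_exp_one_add_div hC hδ
  set L := Real.log (Real.exp 1 + C / δ)
  have hc : 1 ≤ 1 + |Real.log C| := by linarith [abs_nonneg (Real.log C)]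
  set c := 1 + |Real.log C|
  have hl : 0 < l := hm.trans_le hml
  have h3 : 1 ≤ c * L := by nlinarith
  have h4 : 1 ≤ 1 / m * l := by
    rw [one_div, inv_mul_eq_div, le_div_iff₀ hm]
    linarith
  have h5 : E * l ≤ E * l * (c * L) := le_mul_of_one_le_right (by positivity) h3
  have h6 : c * L ≤ 1 / m * l * (c * L) := le_mul_of_one_le_left (by linarith) h4
  rw [div_eq_mul_inv, Real.log_mul hN.ne' (by positivity)]
  linarith

/-! ### Sub-Gaussian tails and the union bound. -/

theorem HasSubgaussianMGF.mono_param {Ω : Type*} [MeasurableSpace Ω] {P : Measure Ω}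
    {X : Ω → ℝ} {c c' : ℝ≥0} (h : HasSubgaussianMGF X c P) (hc : c ≤ c') :
    HasSubgaussianMGF X c' P where
  integrable_exp_mul := h.integrable_exp_mul
  mgf_le s := (h.mgf_le s).trans (by gcongr)

section Noise

variable {Ω : Type*} [MeasurableSpace Ω] {P : Measure Ω}
  {ε : ℕ → Ω → ℝ} {ς : ℝ≥0} {t : ℕ}

/-- Using `ς + 1` instead of `ς` keeps the proxy nonzero for `ς = 0` when `τ > 0`, so that the tail
exponent can be simplified. -/
theorem IsSubGaussianNoise.hasSubgaussianMGF_dotProduct (hε : IsSubGaussianNoise P ε ς)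
    (w : Fin t → ℝ) {τ : ℝ≥0} (hw : w ⬝ᵥ w ≤ (τ : ℝ) ^ 2) :
    HasSubgaussianMGF (fun ω => w ⬝ᵥ fun j : Fin t => ε j ω) ((τ * (ς + 1)) ^ 2) P := by
  have hind : iIndepFun (fun (j : Fin t) ω => w j * ε j ω) P :=
    (hε.indep.precomp Fin.val_injective).comp (fun j y => w j * y)
      fun j => measurable_const_mul (w j)
  have hscale : ∀ j : Fin t, HasSubgaussianMGF (fun ω => w j * ε j ω)
      (Real.nnabs (w j) ^ 2 * ς ^ 2) P := fun j => by
    refine HasSubgaussianMGF.mono_param ((hε.subgaussian j).const_mul (w j)) ?_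
    rw [← NNReal.coe_le_coe]
    change w j ^ 2 * (ς : ℝ) ^ 2 ≤ |w j| ^ 2 * (ς : ℝ) ^ 2
    rw [sq_abs]
  have h := HasSubgaussianMGF.sum_of_iIndepFun hind (s := Finset.univ) fun j _ => hscale j
  refine HasSubgaussianMGF.mono_param h ?_
  rw [← Finset.sum_mul, mul_pow]
  gcongr
  · rw [← NNReal.coe_le_coe]
    push_cast
    refine le_trans (le_of_eq ?_) hw
    exact Finset.sum_congr rfl fun j _ => by
      rw [sq_abs, pow_two]
  · exact le_self_add

theorem IsSubGaussianNoise.measure_abs_dotProduct_gt_le [IsProbabilityMeasure P]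
    (hε : IsSubGaussianNoise P ε ς) (w : Fin t → ℝ) {τ u : ℝ} (hτ : 0 < τ) (hu : 0 ≤ u) (hw : w ⬝ᵥ w ≤ τ ^ 2) :
    P.real {ω | (ς + 1) * u * τ < |w ⬝ᵥ fun j : Fin t => ε j ω|} ≤
      2 * Real.exp (-u ^ 2 / 2) := by
  lift τ to ℝ≥0 using hτ.le
  have hlev : 0 ≤ ((ς : ℝ) + 1) * u * τ := by positivity
  have h := hε.hasSubgaussianMGF_dotProduct w hw
  have h1 := h.measure_ge_le hlev
  have h2 := h.neg.measure_ge_le hlev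
  have hexp : -(((ς : ℝ) + 1) * u * τ) ^ 2 / (2 * (((τ * (ς + 1)) ^ 2 : ℝ≥0) : ℝ)) =
      -u ^ 2 / 2 := by
    push_cast
    have : (ς : ℝ) + 1 ≠ 0 := by positivity
    field_simp
  rw [hexp] at h1 h2
  refine le_trans (measureReal_mono (fun ω hω => ?_) (measure_ne_top _ _))
    ((measureReal_union_le _ _).trans ((add_le_add h1 h2).trans_eq (two_mul _).symm))
  rcases lt_abs.1 (Set.mem_ofPred_eq ▸ hω) with hlt | hlt
  · exact Or.inl hlt.le
  · exact Or.inr hlt.le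

theorem IsSubGaussianNoise.le_measure_forall_abs_dotProduct_le [IsProbabilityMeasure P]
    (hε : IsSubGaussianNoise P ε ς) {ι : Type*} [Fintype ι] (w : ι → Fin t → ℝ) {τ : ι → ℝ}
    {u δ : ℝ} (hτ : ∀ i, 0 < τ i) (hu : 0 ≤ u) (hw : ∀ i, w i ⬝ᵥ w i ≤ τ i ^ 2)
    (hδ : 2 * Fintype.card ι * Real.exp (-u ^ 2 / 2) ≤ δ) :
    1 - δ ≤ P.real {ω | ∀ i, |w i ⬝ᵥ fun j : Fin t => ε j ω| ≤ (ς + 1) * u * τ i} := by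
  set bad : ι → Set Ω := fun i => {ω | (ς + 1) * u * τ i < |w i ⬝ᵥ fun j : Fin t => ε j ω|}
  have h1 : P.real (⋃ i, bad i) ≤ δ := by
    refine (measureReal_iUnion_fintype_le bad).trans (le_trans (Finset.sum_le_sum fun i _ =>
      hε.measure_abs_dotProduct_gt_le (w i) (hτ i) hu (hw i)) ?_)
    rw [Finset.sum_const, Finset.card_univ, nsmul_eq_mul]
    linarith
  have h2 : (1 : ℝ) ≤ P.real
      ({ω | ∀ i, |w i ⬝ᵥ fun j : Fin t => ε j ω| ≤ (ς + 1) * u * τ i} ∪ ⋃ i, bad i) := by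
    refine (probReal_univ (μ := P)).ge.trans ?_
    refine measureReal_mono (fun ω _ => ?_) (measure_ne_top _ _)
    by_cases hω : ∀ i, |w i ⬝ᵥ fun j : Fin t => ε j ω| ≤ (ς + 1) * u * τ i
    · exact Or.inl hω
    · push Not at hω
      exact Or.inr (Set.mem_iUnion.2 hω)
  linarith [measureReal_union_le (μ := P)
    {ω | ∀ i, |w i ⬝ᵥ fun j : Fin t => ε j ω| ≤ (ς + 1) * u * τ i} (⋃ i, bad i)]

end Noise

/-! ### Measurability, passage from the net to `D`, and conclusion. -/

/-- Although `D` may be uncountable, the condition is closed in the noise vector, being an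
intersection of closed conditions. -/
theorem measurableSet_errorBoundEvent {Ω : Type*} [MeasurableSpace Ω] {d : ℕ}
    (k : Eucl d → Eucl d → ℝ) (D : Set (Eucl d)) (ρ : ℝ) (t : ℕ) (x : Fin t → Eucl d)
    {ε : ℕ → Ω → ℝ} (hε : ∀ j, Measurable (ε j)) (C₁ CsubG δ : ℝ) :
    MeasurableSet (errorBoundEvent k D ρ t x ε C₁ CsubG δ) := by
  have hclosed : IsClosed {e : Fin t → ℝ | ∀ z ∈ D, |randomError k ρ x e z| ≤
      C₁ * posteriorStd k ρ x z *
        √(Real.log (1 + ρ * t) * Real.log (Real.exp 1 + CsubG / δ))} := by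
    simp only [Set.ofPred_forall]
    refine isClosed_iInter fun z => isClosed_iInter fun _ => isClosed_le ?_ continuous_const
    unfold randomError
    fun_prop
  exact (measurable_pi_lambda (fun ω (j : Fin t) => ε j ω) fun j => hε j) hclosed.measurableSet

theorem abs_dotProduct_le_of_forall_abs_le {t : ℕ} {v e : Fin t → ℝ} {U η : ℝ} (hU : 0 ≤ U)
    (hη : 0 ≤ η) (he : ∀ j, |e j| ≤ U) (hv : t * (v ⬝ᵥ v) ≤ η ^ 2) : |v ⬝ᵥ e| ≤ U * η := by
  have h1 : (v ⬝ᵥ e) ^ 2 ≤ (∑ j, v j ^ 2) * ∑ j, e j ^ 2 :=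
    Finset.sum_mul_sq_le_sq_mul_sq Finset.univ v e
  have h2 : ∑ j, e j ^ 2 ≤ t * U ^ 2 := by
    refine (Finset.sum_le_sum fun j _ => sq_le_sq' (abs_le.1 (he j)).1
      (abs_le.1 (he j)).2).trans_eq ?_
    simp
  have h3 : ∑ j, v j ^ 2 = v ⬝ᵥ v := Finset.sum_congr rfl fun j _ => pow_two (v j)
  refine abs_le_of_sq_le_sq ?_ (mul_nonneg hU hη)
  calc (v ⬝ᵥ e) ^ 2 ≤ (v ⬝ᵥ v) * (t * U ^ 2) := by
        rw [← h3]
        exact h1.trans (mul_le_mul_of_nonneg_left h2 (Finset.sum_nonneg fun j _ => sq_nonneg _))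
    _ = U ^ 2 * (t * (v ⬝ᵥ v)) := by ring
    _ ≤ U ^ 2 * η ^ 2 := by gcongr
    _ = (U * η) ^ 2 := by ring

/-- The factor is `3 = 2 + 1`: the value at `y` costs `2` since `σ²(y) ≤ 4 σ²(z)`, and the increment
costs `1` by Cauchy–Schwarz. -/
theorem IsCovarianceOn.abs_dotProduct_regWeight_le {d t : ℕ} {k : Eucl d → Eucl d → ℝ}
    {D : Set (Eucl d)} {x : Fin t → Eucl d} {ρ U : ℝ} {e : Fin t → ℝ}
    (hk : IsCovarianceOn k D) (hx : ∀ j, x j ∈ D) (hρ : 0 < ρ) (ht : 1 ≤ t) (hU : 0 ≤ U)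
    (he : ∀ j, |e j| ≤ U) {y z : Eucl d} (hy : y ∈ D) (hz : z ∈ D)
    (hey : |regWeight k ρ x y ⬝ᵥ e| ≤ U * √(posteriorVar k ρ x y / ρ))
    (hyz : t * (k z z - 2 * k z y + k y y) ≤ posteriorVar k ρ x z) :
    |regWeight k ρ x z ⬝ᵥ e| ≤ 3 * (U * √(posteriorVar k ρ x z / ρ)) := by
  have ht' : (1 : ℝ) ≤ t := by exact_mod_cast ht
  have h1 := hk.mul_regWeight_sub_sq_le hx hρ hz hy
  have hη : 0 ≤ k z z - 2 * k z y + k y y :=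
    (mul_nonneg hρ.le (dotProduct_self_nonneg_real _)).trans h1
  have hv : 0 ≤ posteriorVar k ρ x z := le_trans (by positivity) hyz
  have h2 : k z z - 2 * k z y + k y y ≤ posteriorVar k ρ x z := by nlinarith
  have h3 := hk.posteriorVar_le_two_mul_add hx hρ hy hz
  rw [hk.symm hy hz] at h3
  have h4 : √(posteriorVar k ρ x y / ρ) ≤ 2 * √(posteriorVar k ρ x z / ρ) := by
    refine Real.sqrt_le_iff.2 ⟨by positivity, ?_⟩
    rw [mul_pow, Real.sq_sqrt (by positivity), ← mul_div_assoc]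
    gcongr
    linarith
  have h5 : |(regWeight k ρ x z - regWeight k ρ x y) ⬝ᵥ e| ≤
      U * √(posteriorVar k ρ x z / ρ) := by
    refine abs_dotProduct_le_of_forall_abs_le hU (Real.sqrt_nonneg _) he ?_
    rw [Real.sq_sqrt (by positivity), le_div_iff₀ hρ]
    refine le_trans (le_of_eq (by ring)) ((mul_le_mul_of_nonneg_left h1
      (Nat.cast_nonneg t)).trans hyz)
  rw [sub_dotProduct] at h5
  have h6 := mul_le_mul_of_nonneg_left h4 hU
  have h7 := abs_sub_abs_le_abs_sub (regWeight k ρ x z ⬝ᵥ e) (regWeight k ρ x y ⬝ᵥ e)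
  linarith

theorem errorBoundEvent_eq_univ_of_nonpos {Ω : Type*} {d t : ℕ} {Ψ : Eucl d → ℝ}
    {D : Set (Eucl d)} {x : Fin t → Eucl d} (ε : ℕ → Ω → ℝ)
    (hk : IsCovarianceOn (stationaryKernel Ψ) D) (hx : ∀ j, x j ∈ D) (hΨ : Ψ 0 ≤ 0)
    (ρ : ℝ) {C₁ : ℝ} (hC : 0 ≤ C₁) (CsubG δ : ℝ) :
    errorBoundEvent (stationaryKernel Ψ) D ρ t x ε C₁ CsubG δ = Set.univ := by
  refine Set.eq_univ_of_forall fun ω z hz => ?_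
  have hzero : kernelVec (stationaryKernel Ψ) x z = 0 := by
    funext j
    have h := hk.two_mul_abs_le hz (hx j)
    have hdiag : ∀ y : Eucl d, stationaryKernel Ψ y y = Ψ 0 := fun y => by
      rw [stationaryKernel, sub_self]
    rw [hdiag, hdiag] at h
    exact abs_nonpos_iff.1 (by change |stationaryKernel Ψ z (x j)| ≤ 0; linarith)
  rw [randomError, hzero, zero_dotProduct, abs_zero]
  unfold posteriorStd
  positivity

theorem exists_errorBoundEvent_constant {d : ℕ} {D : Set (Eucl d)} {Ψ : Eucl d → ℝ} {ρ : ℝ}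
    (hD : Bornology.IsBounded D) (hρ : 0 < ρ) (hk : IsCovarianceOn (stationaryKernel Ψ) D)
    (hH : IsHolderOn Ψ D) (hΨ : 0 < Ψ 0) :
    ∃ b : ℝ, 0 < b ∧ ∀ (ς : ℝ≥0) (CsubG : ℝ), 0 < CsubG → ∀ (t : ℕ), 1 ≤ t →
      ∀ (δ : ℝ), 0 < δ → δ < 1 → ∀ (x : Fin t → Eucl d), (∀ j, x j ∈ D) →
      ∀ (Ω : Type*) [MeasurableSpace Ω] (P : Measure Ω) [IsProbabilityMeasure P]
        (ε : ℕ → Ω → ℝ), IsSubGaussianNoise P ε ς →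
        1 - δ ≤ P.real (errorBoundEvent (stationaryKernel Ψ) D ρ t x ε
          ((ς + 1) * √(1 + |Real.log CsubG|) * b) CsubG δ) := by
  obtain ⟨A, hA, θ, hθ, hhol⟩ := hH
  -- Chosen so that `le_mul_posteriorVar` yields `σ_t² ≥ c / t` for all `t ≥ 1`.
  set c : ℝ := Ψ 0 / (2 * (1 + Ψ 0 / ρ)) with hc
  have hc0 : 0 < c := by positivity
  obtain ⟨B, hB, p, hnet⟩ := exists_net_card_le_mul_pow hD (show 0 < 2 * A by positivity) hθ hc0
  obtain ⟨E, hE, hlog⟩ := exists_log_two_mul_add_le hB hρ p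
  have hl : 0 < Real.log (1 + ρ) := Real.log_pos (by linarith)
  refine ⟨3 * √(2 * (E + 1 / Real.log (1 + ρ))) / √ρ, by positivity, ?_⟩
  intro ς C hC t ht δ hδ hδ1 x hx Ω _ P _ ε hε
  have ht' : (1 : ℝ) ≤ t := by exact_mod_cast ht
  have ht0 : (0 : ℝ) < t := by linarith
  obtain ⟨s, hsD, hs, hcard⟩ := hnet t ht
  have hkd : ∀ z ∈ D, stationaryKernel Ψ z z = Ψ 0 := fun z _ => by simp [stationaryKernel]
  have hvar : ∀ z ∈ D, c / t ≤ posteriorVar (stationaryKernel Ψ) ρ x z := by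
    intro z hz
    have h1 := hk.le_mul_posteriorVar hx hρ hkd hz
    have h2 : 0 < posteriorVar (stationaryKernel Ψ) ρ x z :=
      pos_of_mul_pos_right (hΨ.trans_le h1) (by positivity)
    have h3 : 1 + t * Ψ 0 / ρ ≤ t * (1 + Ψ 0 / ρ) := by
      rw [mul_add, mul_div_assoc]
      linarith
    rw [hc, div_div, div_le_iff₀ (by positivity)]
    refine h1.trans ?_
    nlinarith
  have hvpos : ∀ z ∈ D, 0 < posteriorVar (stationaryKernel Ψ) ρ x z := fun z hz =>
    lt_of_lt_of_le (by positivity) (hvar z hz)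
  set N : ℝ := 2 * (t + s.card) with hN
  have hN0 : 0 < N := by positivity
  have hNδ : 1 ≤ N / δ := by
    rw [le_div_iff₀ hδ]
    have : (0 : ℝ) ≤ s.card := Nat.cast_nonneg _
    linarith
  set u : ℝ := √(2 * Real.log (N / δ)) with hu
  have hlogN : 0 ≤ Real.log (N / δ) := Real.log_nonneg hNδ
  -- One family for one union bound: the noise coordinates at scale `1`, the net points at scale
  -- `σ_t(y) / √ρ`.
  set w : Fin t ⊕ s → Fin t → ℝ :=
    Sum.elim (fun j => Pi.single j 1) (fun y => regWeight (stationaryKernel Ψ) ρ x y) with hw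
  set τ : Fin t ⊕ s → ℝ :=
    Sum.elim (fun _ => 1) (fun y => √(posteriorVar (stationaryKernel Ψ) ρ x y / ρ)) with hτ
  have hτ0 : ∀ i, 0 < τ i := by
    rintro (j | y)
    · simp [hτ]
    · have := hvpos y (hsD y y.2)
      simp only [hτ, Sum.elim_inr]
      positivity
  have hwτ : ∀ i, w i ⬝ᵥ w i ≤ τ i ^ 2 := by
    rintro (j | y)
    · simp [hτ, hw]
    · have := hvpos y (hsD y y.2)
      simp only [hτ, hw, Sum.elim_inr]
      rw [Real.sq_sqrt (by positivity), le_div_iff₀ hρ, mul_comm]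
      exact hk.mul_regWeight_sq_le hx hρ (hsD y y.2)
  have hexp : 2 * (Fintype.card (Fin t ⊕ s) : ℝ) * Real.exp (-u ^ 2 / 2) ≤ δ := by
    have h1 : -u ^ 2 / 2 = -Real.log (N / δ) := by
      rw [hu, Real.sq_sqrt (by positivity)]
      ring
    rw [h1, Real.exp_neg, Real.exp_log (by positivity)]
    simp only [Fintype.card_sum, Fintype.card_fin, Fintype.card_coe, Nat.cast_add]
    rw [← hN]
    exact le_of_eq (by field_simp)
  refine (hε.le_measure_forall_abs_dotProduct_le w hτ0 (Real.sqrt_nonneg _) hwτ hexp).trans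
    (measureReal_mono (fun ω hω z hz => ?_) (measure_ne_top _ _))
  have hU : 0 ≤ ((ς : ℝ) + 1) * u := by positivity
  have he : ∀ j : Fin t, |ε j ω| ≤ (ς + 1) * u := fun j => by
    have h1 := hω (Sum.inl j)
    simp only [hw, hτ, Sum.elim_inl, single_one_dotProduct, mul_one] at h1
    exact h1
  obtain ⟨y, hy, hzy⟩ := hs z hz
  have hey := hω (Sum.inr ⟨y, hy⟩)
  simp only [hw, hτ, Sum.elim_inr] at hey
  have hclose : t * (stationaryKernel Ψ z z - 2 * stationaryKernel Ψ z y
      + stationaryKernel Ψ y y) ≤ posteriorVar (stationaryKernel Ψ) ρ x z := by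
    rw [hkd z hz, hkd y (hsD y hy)]
    have h1 := hhol z hz y (hsD y hy)
    have h2 : Ψ 0 - 2 * stationaryKernel Ψ z y + Ψ 0 ≤ c / t ^ 2 := by
      simp only [stationaryKernel]
      linarith
    calc _ ≤ t * (c / t ^ 2) := by gcongr
      _ = c / t := by field_simp
      _ ≤ _ := hvar z hz
  have hmain := hk.abs_dotProduct_regWeight_le hx hρ ht hU he (hsD y hy) hz hey hclose
  rw [randomError, hk.kernelVec_dotProduct_regInv hx hρ]
  refine hmain.trans ?_
  have hu_le : u ≤ √(2 * (E + 1 / Real.log (1 + ρ))) * √(1 + |Real.log C|) *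
      √(Real.log (1 + ρ * t) * Real.log (Real.exp 1 + C / δ)) := by
    rw [← Real.sqrt_mul (by positivity), ← Real.sqrt_mul (by positivity), hu]
    refine Real.sqrt_le_sqrt ?_
    have := log_div_le_mul_log_mul_log hN0 hE.le hl
      (Real.log_le_log (by positivity) (by nlinarith : 1 + ρ ≤ 1 + ρ * t)) (hlog t _ ht hcard)
      hC hδ
    linarith
  have hstd : posteriorStd (stationaryKernel Ψ) ρ x z =
      √(posteriorVar (stationaryKernel Ψ) ρ x z) := rfl
  rw [hstd, Real.sqrt_div (hvpos z hz).le]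
  calc 3 * ((ς + 1) * u * (√(posteriorVar (stationaryKernel Ψ) ρ x z) / √ρ))
      ≤ 3 * ((ς + 1) * (√(2 * (E + 1 / Real.log (1 + ρ))) * √(1 + |Real.log C|) *
      √(Real.log (1 + ρ * t) * Real.log (Real.exp 1 + C / δ))) *
        (√(posteriorVar (stationaryKernel Ψ) ρ x z) / √ρ)) := by gcongr
    _ = _ := by ring

theorem proposition2 :
    ∃ a : ℝ≥0 → ℝ → ℝ, (∀ ς C, 0 < a ς C) ∧
      ∀ (d : ℕ) (D : Set (Eucl d)) (Ψ : Eucl d → ℝ) (ρ : ℝ),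
        IsCompact D → Convex ℝ D → 0 < ρ →
        IsCovarianceOn (stationaryKernel Ψ) D → IsHolderOn Ψ D →
        ∃ b : ℝ, 0 < b ∧
          ∀ (ς : ℝ≥0) (CsubG : ℝ), 0 < CsubG →
          ∀ (t : ℕ), 1 ≤ t → ∀ (δ : ℝ), 0 < δ → δ < 1 →
          ∀ (x : Fin t → Eucl d), (∀ j, x j ∈ D) →
          ∀ (Ω : Type*) [MeasurableSpace Ω] (P : Measure Ω) [IsProbabilityMeasure P]
            (ε : ℕ → Ω → ℝ), IsSubGaussianNoise P ε ς →
            MeasurableSet (errorBoundEvent (stationaryKernel Ψ) D ρ t x ε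
                (a ς CsubG * b) CsubG δ) ∧
              1 - δ ≤ P.real (errorBoundEvent (stationaryKernel Ψ) D ρ t x ε
                (a ς CsubG * b) CsubG δ) := by
  refine ⟨fun ς C => (ς + 1) * √(1 + |Real.log C|), fun ς C => by positivity, ?_⟩
  intro d D Ψ ρ hD _ hρ hk hH
  rcases lt_or_ge 0 (Ψ 0) with hΨ | hΨ
  · obtain ⟨b, hb, h⟩ := exists_errorBoundEvent_constant hD.isBounded hρ hk hH hΨ
    exact ⟨b, hb, fun ς C hC t ht δ hδ hδ1 x hx Ω _ P _ ε hε =>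
      ⟨measurableSet_errorBoundEvent _ D ρ t x hε.measurable _ C δ,
        h ς C hC t ht δ hδ hδ1 x hx Ω P ε hε⟩⟩
  · refine ⟨1, one_pos, fun ς C _ t _ δ hδ _ x hx Ω _ P _ ε hε =>
      ⟨measurableSet_errorBoundEvent _ D ρ t x hε.measurable _ C δ, ?_⟩⟩
    rw [errorBoundEvent_eq_univ_of_nonpos ε hk hx hΨ ρ (by positivity), probReal_univ]
    linarith
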